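/- Let $p,m\in\mathbb{N}$ and let $\alpha=(\alpha_1,\dots,\alpha_p)$ with $\alpha_i\in(0,\infty)\setminus\mathbb{N}$. Put $n_i=[\alpha_i]+1$ and $\mathbf{n}=(n_1,\dots,n_p)$, and say that $\mathbf{x}=(x_1,\dots,x_p)$ is of class $C^{\mathbf n}$ on $(0,\infty)$ if each $x_i$ is of class $C^{n_i}$ on $(0,\infty)$. For an order $\beta\in(0,\infty)\setminus\mathbb{N}$ and $n=[\beta]+1$, consider the three fractional derivatives at $t>0$ $$^{C}D^{\beta}g(t)=\frac{1}{\Gamma(n-\beta)}\int_0^t(t-s)^{n-\beta-1}g^{(n)}(s)\,ds,\qquad {}^{RL}D^{\beta}g(t)=\frac{1}{\Gamma(n-\beta)}\Big(\frac{d}{dt}\Big)^{n}\int_0^t(t-s)^{n-\beta-1}g(s)\,ds,$$ $$^{GL}D^{\beta}g(t)=\lim_{h\to0^+}h^{-\beta}\sum_{r=0}^{[t/h]}(-1)^r\binom{\beta}{r}g(t-rh)$$ (Caputo, Riemann–Liouville, Grünwald–Letnikov). Let $\mathbf f:[0,\infty)\times\mathbb{R}^{p(m+1)}\to\mathbb{R}^p$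 be any function that is $T$-periodic in its first argument, where $T>0$, i.e. $\mathbf f(t+T,v)=\mathbf f(t,v)$ for all $t\ge 0$ and all $v$. Consider the system $$D^{\alpha}\mathbf{x}(t)=\mathbf f\big(t,\mathbf x(t),\mathbf x'(t),\dots,\mathbf x^{(m)}(t)\big),\qquad t>0,$$ where $D^{\alpha}\mathbf x=(D^{\alpha_1}x_1,\dots,D^{\alpha_p}x_p)^{T}$ and each $D^{\alpha_i}$ is one of the three fractional derivatives above (the choice may depend on $i$). Then for every integer $k\ge1$ the system has no solution of class $C^{\mathbf n}$ that is $kT$-periodic (that is, $\mathbf x(t+kT)=\mathbf x(t)$ for all $t>0$) and non-constant on $(0,\infty)$. -/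

import Mathlib

open Filter Topology

/-- The three classical notions of fractional-order derivative. -/
inductive FracKind where
  | caputo
  | riemannLiouville
  | grunwaldLetnikov

/-- The integer `n = [α] + 1` attached to an order of differentiation `α > 0`. -/
noncomputable def fracOrder (α : ℝ) : ℕ := ⌊α⌋₊ + 1

/-- Caputo derivative of order `α` with lower terminal `0`:
`1 / Γ(n - α) * ∫₀ᵗ (t - s)^(n - α - 1) g⁽ⁿ⁾(s) ds`, where `n = [α] + 1`. -/
noncomputable def caputoDeriv (α : ℝ) (g : ℝ → ℝ) (t : ℝ) : ℝ :=
  1 / Real.Gamma ((fracOrder α : ℝ) - α) *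
    ∫ s in (0 : ℝ)..t, (t - s) ^ ((fracOrder α : ℝ) - α - 1) * iteratedDeriv (fracOrder α) g s

/-- Riemann-Liouville derivative of order `α` with lower terminal `0`:
`1 / Γ(n - α) * (d/dt)ⁿ ∫₀ᵗ (t - s)^(n - α - 1) g(s) ds`, where `n = [α] + 1`. -/
noncomputable def rlDeriv (α : ℝ) (g : ℝ → ℝ) (t : ℝ) : ℝ :=
  1 / Real.Gamma ((fracOrder α : ℝ) - α) *
    iteratedDeriv (fracOrder α)
      (fun u : ℝ => ∫ s in (0 : ℝ)..u, (u - s) ^ ((fracOrder α : ℝ) - α - 1) * g s) t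

/-- The Grunwald-Letnikov difference quotient of step `h > 0` with lower terminal `0`:
`h^(-α) * ∑_{r = 0}^{[t / h]} (-1)^r (α choose r) g(t - r h)`. -/
noncomputable def glQuotient (α : ℝ) (g : ℝ → ℝ) (t h : ℝ) : ℝ :=
  h ^ (-α) * ∑ r ∈ Finset.range (⌊t / h⌋₊ + 1),
    (-1 : ℝ) ^ r * Ring.choose α r * g (t - r * h)

/-- `HasFracDeriv K α g t y`: the fractional derivative of kind `K` and order `α` (with lower
terminal `0`) of `g` at the time `t` is `y`. -/
def HasFracDeriv : FracKind → ℝ → (ℝ → ℝ) → ℝ → ℝ → Prop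
  | .caputo, α, g, t, y => caputoDeriv α g t = y
  | .riemannLiouville, α, g, t, y => rlDeriv α g t = y
  | .grunwaldLetnikov, α, g, t, y => Tendsto (glQuotient α g t) (𝓝[>] 0) (𝓝 y)

/-- `x` is of class `C^𝐧` on the open half-line, `𝐧 = ([α₁] + 1, …, [α_p] + 1)`. -/
def IsClassCn {p : ℕ} (α : Fin p → ℝ) (x : ℝ → Fin p → ℝ) : Prop :=
  ∀ i, ContDiffOn ℝ (fracOrder (α i) : ℕ) (fun s => x s i) (Set.Ioi 0)

/-- `x` solves `D^α x(t) = f(t, x(t), x'(t), …, x⁽ᵐ⁾(t))` for `t > 0`, where the derivative in the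
`i`-th component is of kind `K i` and order `α i`. The derivatives of `x` up to the order `m`
are required to exist. The argument `v` of `f t v` stands for the array `v j i = x_i⁽ʲ⁾(t)`. -/
def IsFracSolution {p : ℕ} (K : Fin p → FracKind) (α : Fin p → ℝ) (m : ℕ)
    (f : ℝ → (Fin (m + 1) → Fin p → ℝ) → Fin p → ℝ) (x : ℝ → Fin p → ℝ) : Prop :=
  ∀ t : ℝ, 0 < t →
    (∀ i, ∀ j < m, DifferentiableAt ℝ (iteratedDeriv j (fun s => x s i)) t) ∧
    ∀ i, HasFracDeriv (K i) (α i) (fun s => x s i) t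
      (f t (fun j l => iteratedDeriv j (fun s => x s l) t) i)

/-!
Let `G` be a function of period `P` with a `P`-periodic fractional derivative. The increment of the
derivative from `t` to `t + P` is zero, and for each of the three derivatives it equals the part of
a fractional integral at the time `t + P` that is due to a function `w` on the first period
`[0, P]`; its order is nonintegral, and `w` is `G` itself, or `G⁽ⁿ⁾` in the Caputo case. So
`∫₀ᴾ (u - s) ^ β * w s = 0` for arbitrarily large `u`. After division by `u ^ β` the left-hand side
is a power series in `1 / u`, whose coefficients are nonzero multiples of the moments of `w` on
`[0, P]`. All moments vanish, and `w = 0` by the Weierstrass approximation theorem. In the Caputo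
case `G⁽ⁿ⁾ = 0` makes the periodic function `G` constant.

For the Grünwald–Letnikov derivative the steps `P / N` are used at the times `j * P`: the weights
`(-1) ^ r * (α choose r)` are asymptotic to `r ^ (-α - 1) / Γ(-α)`, so the terms of the sum that are
new in `[j * P, (j + 1) * P]` form a Riemann sum.
-/

open MeasureTheory (volume)

/-! ### Binomial weights and moments -/

theorem factorial_mul_choose_eq_prod_range (a : ℝ) (n : ℕ) :
    n.factorial * Ring.choose a n = ∏ j ∈ Finset.range n, (a - j) := by
  rw [← nsmul_eq_mul, ← Ring.descPochhammer_eq_factorial_smul_choose,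
    Polynomial.descPochhammer_smeval_eq_ascPochhammer, Polynomial.ascPochhammer_smeval_eq_eval,
    ← descPochhammer_eval_eq_ascPochhammer, descPochhammer_eval_eq_prod_range]

theorem choose_ne_zero_of_ne_natCast {a : ℝ} (ha : ∀ j : ℕ, a ≠ j) (n : ℕ) :
    Ring.choose a n ≠ 0 := by
  refine right_ne_zero_of_mul (a := (n.factorial : ℝ)) ?_
  rw [factorial_mul_choose_eq_prod_range]
  exact Finset.prod_ne_zero_iff.2 fun j _ ↦ sub_ne_zero.2 (ha j)

theorem neg_one_pow_mul_choose_eq_prod_div (a : ℝ) (n : ℕ) :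
    (-1) ^ n * Ring.choose a n = (∏ j ∈ Finset.range n, (-a + j)) / n.factorial := by
  rw [eq_div_iff (by exact_mod_cast n.factorial_ne_zero), mul_assoc, mul_comm (Ring.choose a n),
    factorial_mul_choose_eq_prod_range, ← Finset.card_range n, ← Finset.prod_const,
    Finset.card_range, ← Finset.prod_mul_distrib]
  exact Finset.prod_congr rfl fun j _ ↦ by ring

theorem tendsto_neg_one_pow_mul_choose_mul_rpow_add_one {a : ℝ} (ha : ∀ j : ℕ, a ≠ j) :
    Tendsto (fun r : ℕ ↦ (-1) ^ r * Ring.choose a r * (r : ℝ) ^ (a + 1)) atTop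
      (𝓝 (Real.Gamma (-a))⁻¹) := by
  have hΓ : Real.Gamma (-a) ≠ 0 := Real.Gamma_ne_zero fun m h ↦ ha m (neg_injective h)
  have hlim : Tendsto (fun r : ℕ ↦ (Real.GammaSeq (-a) r)⁻¹ * ((r : ℝ) / (r + -a))) atTop
      (𝓝 (Real.Gamma (-a))⁻¹) := by
    simpa only [mul_one] using ((Real.GammaSeq_tendsto_Gamma (-a)).inv₀ hΓ).mul
      (tendsto_natCast_div_add_atTop (-a))
  refine hlim.congr' ?_
  filter_upwards [eventually_gt_atTop 0] with r hr
  have hr' : (0 : ℝ) < r := Nat.cast_pos.2 hr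
  have hne (j : ℕ) : -a + (j : ℝ) ≠ 0 := fun h ↦ ha j (by linarith)
  have hprod : (∏ j ∈ Finset.range r, (-a + j : ℝ)) ≠ 0 := Finset.prod_ne_zero_iff.2 fun j _ ↦ hne j
  have hfactorial : (r.factorial : ℝ) ≠ 0 := by exact_mod_cast r.factorial_ne_zero
  have hrpow : (r : ℝ) ^ a ≠ 0 := (Real.rpow_pos_of_pos hr' a).ne'
  have hlast := hne r
  rw [neg_one_pow_mul_choose_eq_prod_div, Real.GammaSeq, Finset.prod_range_succ,
    Real.rpow_neg hr'.le, Real.rpow_add_one hr'.ne', add_comm (r : ℝ)]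
  field_simp

theorem tendsto_neg_one_pow_mul_choose_mul_rpow {a : ℝ} (ha : ∀ j : ℕ, a ≠ j) :
    Tendsto (fun r : ℕ ↦ (-1) ^ r * Ring.choose a r * (r : ℝ) ^ a) atTop (𝓝 0) := by
  have h := (tendsto_neg_one_pow_mul_choose_mul_rpow_add_one ha).mul
    tendsto_inv_atTop_nhds_zero_nat
  rw [mul_zero] at h
  refine h.congr' ?_
  filter_upwards [eventually_gt_atTop 0] with r hr
  have hr' : (r : ℝ) ≠ 0 := by exact_mod_cast hr.ne'
  rw [Real.rpow_add_one hr', ← mul_assoc, mul_inv_cancel_right₀ hr']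

theorem hasSum_choose_mul_pow {β y : ℝ} (hy : |y| < 1) :
    HasSum (fun k ↦ Ring.choose β k * y ^ k) ((1 + y) ^ β) := by
  have h := (Real.one_add_rpow_hasFPowerSeriesOnBall_zero (a := β)).hasSum (y := y)
    (by simpa [enorm_eq_nnnorm, ← NNReal.coe_lt_coe] using hy)
  simpa only [binomialSeries_apply, List.ofFn_const, List.prod_replicate, smul_eq_mul, zero_add]
    using h

theorem hasSum_integral_one_sub_mul_rpow_mul {β P z : ℝ} (hP : 0 ≤ P) (hz : |z| * P < 1)
    {w : ℝ → ℝ} (hw : IntervalIntegrable w volume 0 P) :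
    HasSum (fun k ↦ z ^ k * ((-1) ^ k * Ring.choose β k * ∫ s in 0..P, s ^ k * w s))
      (∫ s in 0..P, (1 - z * s) ^ β * w s) := by
  have hterm (k : ℕ) (s : ℝ) : z ^ k * (-1) ^ k * Ring.choose β k * (s ^ k * w s)
      = Ring.choose β k * (-(z * s)) ^ k * w s := by
    rw [neg_pow (z * s), mul_pow]
    ring
  have hpow (k : ℕ) : IntervalIntegrable (fun s ↦ s ^ k * w s) volume 0 P :=
    hw.continuousOn_mul (by fun_prop)
  have hsummable : Summable fun k ↦ |Ring.choose β k * (|z| * P) ^ k| :=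
    (hasSum_choose_mul_pow (by rwa [abs_of_nonneg (by positivity)])).summable.abs
  simp_rw [← mul_assoc (z ^ _), ← intervalIntegral.integral_const_mul]
  refine intervalIntegral.hasSum_integral_of_dominated_convergence
    (fun k s ↦ |Ring.choose β k * (|z| * P) ^ k| * |w s|)
    (fun k ↦ ((hpow k).const_mul _).def'.aestronglyMeasurable) (fun k ↦ .of_forall fun s hs ↦ ?_)
    (.of_forall fun s _ ↦ hsummable.mul_right _) ?_ (.of_forall fun s hs ↦ ?_)
  · rw [Set.uIoc_of_le hP] at hs
    have hs' : |s| ≤ P := by rw [abs_of_pos hs.1]; exact hs.2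
    rw [hterm, Real.norm_eq_abs, abs_mul, abs_mul, abs_mul, abs_pow, abs_pow, abs_neg, abs_mul,
      abs_of_nonneg (by positivity : 0 ≤ |z| * P)]
    gcongr
  · simp_rw [tsum_mul_right]
    exact hw.abs.const_mul _
  · rw [Set.uIoc_of_le hP] at hs
    have hzs : |-(z * s)| < 1 := by
      rw [abs_neg, abs_mul, abs_of_pos hs.1]
      exact (mul_le_mul_of_nonneg_left hs.2 (abs_nonneg z)).trans_lt hz
    simpa only [hterm, sub_eq_add_neg] using (hasSum_choose_mul_pow hzs).mul_right (w s)

theorem integral_sub_rpow_mul_eq_rpow_mul_integral {β P u : ℝ} (hP : 0 ≤ P) (hu : P < u)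
    (w : ℝ → ℝ) :
    ∫ s in 0..P, (u - s) ^ β * w s = u ^ β * ∫ s in 0..P, (1 - u⁻¹ * s) ^ β * w s := by
  have hu0 : 0 < u := hP.trans_lt hu
  rw [← intervalIntegral.integral_const_mul]
  refine intervalIntegral.integral_congr fun s hs ↦ ?_
  rw [Set.uIcc_of_le hP] at hs
  have hus : u - s = u * (1 - u⁻¹ * s) := by field_simp
  have hnonneg : 0 ≤ 1 - u⁻¹ * s :=
    nonneg_of_mul_nonneg_right (hus ▸ sub_nonneg.2 (hs.2.trans hu.le)) hu0
  simp only [hus, Real.mul_rpow hu0.le hnonneg, mul_assoc]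

theorem integral_pow_mul_eq_zero_of_frequently {β P : ℝ} (hβ : ∀ j : ℕ, β ≠ j) (hP : 0 ≤ P)
    {w : ℝ → ℝ} (hw : IntervalIntegrable w volume 0 P)
    (h : ∃ᶠ u in atTop, ∫ s in 0..P, (u - s) ^ β * w s = 0) (k : ℕ) :
    ∫ s in 0..P, s ^ k * w s = 0 := by
  let H : ℝ → ℝ := fun z ↦ ∫ s in 0..P, (1 - z * s) ^ β * w s
  let c : ℕ → ℝ := fun k ↦ (-1) ^ k * Ring.choose β k * ∫ s in 0..P, s ^ k * w s
  have hseries : HasFPowerSeriesAt H (FormalMultilinearSeries.ofScalars ℝ c) 0 := by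
    have hnear : ∀ᶠ z : ℝ in 𝓝 0, |z| * P < 1 :=
      ContinuousAt.eventually_lt (by fun_prop) (by fun_prop) (by simp)
    refine hasFPowerSeriesAt_iff.2 (hnear.mono fun z hz ↦ ?_)
    simpa only [FormalMultilinearSeries.coeff_ofScalars, smul_eq_mul, zero_add]
      using hasSum_integral_one_sub_mul_rpow_mul hP hz hw
  have hzero : ∃ᶠ z in 𝓝[≠] 0, H z = 0 := by
    refine Tendsto.frequently_map (·⁻¹) ?_ ?_ (h.and_eventually (eventually_gt_atTop P))
    · exact tendsto_inv_atTop_nhdsGT_zero.mono_right (nhdsGT_le_nhdsNE 0)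
    rintro u ⟨hu, hPu⟩
    rw [integral_sub_rpow_mul_eq_rpow_mul_integral hP hPu] at hu
    exact (mul_eq_zero.1 hu).resolve_left (Real.rpow_pos_of_pos (hP.trans_lt hPu) β).ne'
  have hc : c k = 0 := by
    have hzero_series := hseries.locally_zero_iff.1
      (hseries.analyticAt.frequently_zero_iff_eventually_zero.1 hzero)
    rw [← FormalMultilinearSeries.coeff_ofScalars (𝕜 := ℝ) (p := c) (n := k), hzero_series]
    exact FormalMultilinearSeries.coeff_eq_zero.2 rfl
  refine (mul_eq_zero.1 hc).resolve_left (mul_ne_zero ?_ (choose_ne_zero_of_ne_natCast hβ k))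
  exact pow_ne_zero k (by norm_num)

theorem eqOn_zero_of_integral_pow_mul_eq_zero {a b : ℝ} (hab : a < b) {w : ℝ → ℝ}
    (hw : ContinuousOn w (Set.Icc a b)) (h : ∀ k : ℕ, ∫ s in a..b, s ^ k * w s = 0) :
    Set.EqOn w 0 (Set.Icc a b) := by
  have hw' : ContinuousOn w (Set.uIcc a b) := by rwa [Set.uIcc_of_le hab.le]
  have hpoly (p : Polynomial ℝ) : ∫ s in a..b, p.eval s * w s = 0 := by
    simp_rw [Polynomial.eval_eq_sum_range, Finset.sum_mul, mul_assoc]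
    rw [intervalIntegral.integral_finsetSum fun k _ ↦ ContinuousOn.intervalIntegrable (by fun_prop)]
    simp_rw [intervalIntegral.integral_const_mul, h, mul_zero, Finset.sum_const_zero]
  have hsmall (ε : ℝ) (hε : 0 < ε) : ∫ s in a..b, w s ^ 2 ≤ ε * ∫ s in a..b, |w s| := by
    obtain ⟨p, hp⟩ := exists_polynomial_near_of_continuousOn a b w hw ε hε
    calc ∫ s in a..b, w s ^ 2 = ∫ s in a..b, (w s ^ 2 - p.eval s * w s) := by
          rw [intervalIntegral.integral_sub (ContinuousOn.intervalIntegrable (by fun_prop))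
            (ContinuousOn.intervalIntegrable (by fun_prop)), hpoly, sub_zero]
      _ ≤ ∫ s in a..b, ε * |w s| := by
          refine intervalIntegral.integral_mono_on hab.le
            (ContinuousOn.intervalIntegrable (by fun_prop))
            (ContinuousOn.intervalIntegrable (by fun_prop)) fun s hs ↦ ?_
          calc w s ^ 2 - p.eval s * w s = (w s - p.eval s) * w s := by ring
            _ ≤ |w s - p.eval s| * |w s| := (le_abs_self _).trans_eq (abs_mul _ _)
            _ ≤ ε * |w s| := by gcongr; rw [abs_sub_comm]; exact (hp s hs).le
      _ = ε * ∫ s in a..b, |w s| := intervalIntegral.integral_const_mul _ _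
  have hsq : ∫ s in a..b, w s ^ 2 ≤ 0 := by
    refine ge_of_tendsto (f := fun ε : ℝ ↦ ε * ∫ s in a..b, |w s|) (x := 𝓝[>] 0) ?_
      (eventually_mem_nhdsWithin.mono hsmall)
    exact tendsto_nhdsWithin_of_tendsto_nhds (Continuous.tendsto' (by fun_prop) _ _ (zero_mul _))
  intro s hs
  by_contra hne
  exact hsq.not_gt (intervalIntegral.integral_pos hab (hw.pow 2) (fun x _ ↦ sq_nonneg _)
    ⟨s, hs, sq_pos_of_ne_zero hne⟩)

/-! ### Parametric integrals -/

theorem exists_norm_le_of_continuousOn_prod {a b u₀ : ℝ} {U : Set ℝ} (hU : U ∈ 𝓝 u₀)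
    {k : ℝ → ℝ → ℝ} (hk : ContinuousOn (Function.uncurry k) (U ×ˢ Set.uIcc a b)) :
    ∃ V ∈ 𝓝 u₀, V ⊆ U ∧ ∃ B, ∀ u ∈ V, ∀ s ∈ Set.uIcc a b, ‖k u s‖ ≤ B := by
  obtain ⟨V, hV, hVU, hVc⟩ := local_compact_nhds hU
  obtain ⟨B, hB⟩ := (hVc.prod isCompact_uIcc).exists_bound_of_continuousOn
    (hk.mono (Set.prod_mono hVU subset_rfl))
  exact ⟨V, hV, hVU, B, fun u hu s hs ↦ hB (u, s) ⟨hu, hs⟩⟩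

theorem continuousAt_integral_mul_of_continuousOn {a b u₀ : ℝ} {U : Set ℝ} (hU : U ∈ 𝓝 u₀)
    {φ : ℝ → ℝ} (hφ : IntervalIntegrable φ volume a b) {k : ℝ → ℝ → ℝ}
    (hk : ContinuousOn (Function.uncurry k) (U ×ˢ Set.uIcc a b)) :
    ContinuousAt (fun u ↦ ∫ s in a..b, k u s * φ s) u₀ := by
  obtain ⟨V, hV, -, B, hB⟩ := exists_norm_le_of_continuousOn_prod hU hk
  refine intervalIntegral.continuousAt_of_dominated_interval (bound := fun s ↦ B * ‖φ s‖)
    ?_ ?_ (hφ.norm.const_mul B) (.of_forall fun s hs ↦ ?_)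
  · filter_upwards [hU] with u hu
    exact (hφ.continuousOn_mul (hk.uncurry_left u hu)).def'.aestronglyMeasurable
  · filter_upwards [hV] with u hu
    refine .of_forall fun s hs ↦ ?_
    rw [norm_mul]
    gcongr
    exact hB u hu s (Set.uIoc_subset_uIcc hs)
  · exact ((hk.uncurry_right s (Set.uIoc_subset_uIcc hs)).continuousAt hU).mul_const _

theorem hasDerivAt_integral_mul_of_continuousOn {a b u₀ : ℝ} {U : Set ℝ} (hU : U ∈ 𝓝 u₀)
    {φ : ℝ → ℝ} (hφ : IntervalIntegrable φ volume a b) {k k' : ℝ → ℝ → ℝ}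
    (hk : ContinuousOn (Function.uncurry k) (U ×ˢ Set.uIcc a b))
    (hk' : ContinuousOn (Function.uncurry k') (U ×ˢ Set.uIcc a b))
    (hderiv : ∀ u ∈ U, ∀ s ∈ Set.uIcc a b, HasDerivAt (k · s) (k' u s) u) :
    HasDerivAt (fun u ↦ ∫ s in a..b, k u s * φ s) (∫ s in a..b, k' u₀ s * φ s) u₀ := by
  obtain ⟨V, hV, hVU, B, hB⟩ := exists_norm_le_of_continuousOn_prod hU hk'
  have hint {k : ℝ → ℝ → ℝ} (hk : ContinuousOn (Function.uncurry k) (U ×ˢ Set.uIcc a b))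
      {u : ℝ} (hu : u ∈ U) : IntervalIntegrable (fun s ↦ k u s * φ s) volume a b :=
    hφ.continuousOn_mul (hk.uncurry_left u hu)
  have hu₀ := mem_of_mem_nhds hU
  refine (intervalIntegral.hasDerivAt_integral_of_dominated_loc_of_deriv_le hV
    (F' := fun u s ↦ k' u s * φ s) (bound := fun s ↦ B * ‖φ s‖)
    (eventually_of_mem hU fun u hu ↦ (hint hk hu).def'.aestronglyMeasurable)
    (hint hk hu₀) (hint hk' hu₀).def'.aestronglyMeasurable ?_ (hφ.norm.const_mul B) ?_).2
  · refine .of_forall fun s hs u hu ↦ ?_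
    rw [norm_mul]
    gcongr
    exact hB u hu s (Set.uIoc_subset_uIcc hs)
  · exact .of_forall fun s hs u hu ↦
      (hderiv u (hVU hu) s (Set.uIoc_subset_uIcc hs)).mul_const _

theorem contDiff_integral_mul_comp_mul {n : ℕ} {a b : ℝ} {φ g ψ : ℝ → ℝ}
    (hφ : IntervalIntegrable φ volume a b) (hg : ContDiff ℝ n g) (hψ : Continuous ψ) :
    ContDiff ℝ n (fun u ↦ ∫ y in a..b, g (u * ψ y) * φ y) := by
  induction n generalizing φ g with
  | zero =>
    have hg := hg.continuous
    exact contDiff_zero.2 <| continuous_iff_continuousAt.2 fun u₀ ↦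
      continuousAt_integral_mul_of_continuousOn univ_mem hφ (k := fun u y ↦ g (u * ψ y))
        (by fun_prop)
  | succ n ih =>
    push_cast at hg ⊢
    obtain ⟨hg_diff, -, hg'⟩ := contDiff_succ_iff_deriv.1 hg
    have hg_cont := hg_diff.continuous
    have hg'_cont := hg'.continuous
    have hderiv (u₀ : ℝ) : HasDerivAt (fun u ↦ ∫ y in a..b, g (u * ψ y) * φ y)
        (∫ y in a..b, deriv g (u₀ * ψ y) * (ψ y * φ y)) u₀ := by
      simp_rw [← mul_assoc]
      refine hasDerivAt_integral_mul_of_continuousOn univ_mem hφ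
        (k' := fun u y ↦ deriv g (u * ψ y) * ψ y) (by fun_prop) (by fun_prop) fun u _ y _ ↦ ?_
      exact (hg_diff _).hasDerivAt.comp u (hasDerivAt_mul_const (ψ y))
    refine contDiff_succ_iff_deriv.2 ⟨fun u ↦ (hderiv u).differentiableAt, by simp, ?_⟩
    rw [funext fun u ↦ (hderiv u).deriv]
    exact ih (hφ.continuousOn_mul hψ.continuousOn) hg'

/-! ### Fractional integrals -/

/-- The Riemann–Liouville kernel of order `μ`. Since `Γ` vanishes at its poles in Mathlib and
`x / 0 = 0`, it is identically zero when `μ` is a nonpositive integer, and so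
`fracKernel (μ - 1)` is the derivative of `fracKernel μ` for every real `μ`. -/
noncomputable def fracKernel (μ x : ℝ) : ℝ :=
  x ^ (μ - 1) / Real.Gamma μ

/-- The Riemann–Liouville fractional integral of order `μ` with lower terminal `0`. -/
noncomputable def fracIntegral (μ : ℝ) (g : ℝ → ℝ) (u : ℝ) : ℝ :=
  ∫ s in (0 : ℝ)..u, fracKernel μ (u - s) * g s

/-- The part of the fractional integral of order `μ` at the time `u` that is due to the values of
`g` on `[0, P]`. For `P < u` the kernel is not singular there, so every real order makes sense. -/
noncomputable def truncFracIntegral (μ P : ℝ) (g : ℝ → ℝ) (u : ℝ) : ℝ :=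
  ∫ s in (0 : ℝ)..P, fracKernel μ (u - s) * g s

theorem hasDerivAt_fracKernel (μ : ℝ) {x : ℝ} (hx : x ≠ 0) :
    HasDerivAt (fracKernel μ) (fracKernel (μ - 1) x) x := by
  refine ((Real.hasDerivAt_rpow_const (p := μ - 1) (Or.inl hx)).div_const _).congr_deriv ?_
  rcases eq_or_ne (μ - 1) 0 with hμ | hμ
  · simp only [fracKernel, hμ, Real.Gamma_zero, zero_mul, zero_div, div_zero]
  · rw [fracKernel, ← mul_div_mul_left (_ ^ _) (Real.Gamma _) hμ, ← Real.Gamma_add_one hμ,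
      sub_add_cancel]

theorem continuousOn_fracKernel_sub (μ P : ℝ) :
    ContinuousOn (fun z : ℝ × ℝ ↦ fracKernel μ (z.1 - z.2)) (Set.Ioi P ×ˢ Set.Iic P) := by
  have hkernel : ContinuousOn (fracKernel μ) (Set.Ioi 0) := fun x hx ↦
    (hasDerivAt_fracKernel μ (Set.mem_Ioi.1 hx).ne').continuousAt.continuousWithinAt
  exact hkernel.comp (by fun_prop) fun z hz ↦
    Set.mem_Ioi.2 (sub_pos.2 (lt_of_le_of_lt (Set.mem_Iic.1 hz.2) (Set.mem_Ioi.1 hz.1)))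

theorem hasDerivAt_truncFracIntegral {μ P u : ℝ} (hP : 0 ≤ P) (hu : P < u) {w : ℝ → ℝ}
    (hw : IntervalIntegrable w volume 0 P) :
    HasDerivAt (truncFracIntegral μ P w) (truncFracIntegral (μ - 1) P w u) u := by
  have hsub : Set.uIcc 0 P ⊆ Set.Iic P := Set.uIcc_of_le hP ▸ Set.Icc_subset_Iic_self
  refine hasDerivAt_integral_mul_of_continuousOn (Ioi_mem_nhds hu) hw
    (k := fun v s ↦ fracKernel μ (v - s)) (k' := fun v s ↦ fracKernel (μ - 1) (v - s))
    ((continuousOn_fracKernel_sub μ P).mono (Set.prod_mono_right hsub))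
    ((continuousOn_fracKernel_sub (μ - 1) P).mono (Set.prod_mono_right hsub)) fun v hv s hs ↦ ?_
  have hne : v - s ≠ 0 := (sub_pos.2 ((hsub hs).trans_lt hv)).ne'
  exact (hasDerivAt_fracKernel μ hne).comp_sub_const v s

theorem iteratedDeriv_truncFracIntegral {μ P : ℝ} (hP : 0 ≤ P) {w : ℝ → ℝ}
    (hw : IntervalIntegrable w volume 0 P) (n : ℕ) :
    Set.EqOn (iteratedDeriv n (truncFracIntegral μ P w)) (truncFracIntegral (μ - n) P w)
      (Set.Ioi P) := by
  induction n with
  | zero => simp only [iteratedDeriv_zero, Nat.cast_zero, sub_zero, Set.eqOn_refl]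
  | succ n ih =>
    intro u hu
    rw [iteratedDeriv_succ, (ih.eventuallyEq_of_mem (Ioi_mem_nhds hu)).deriv_eq,
      (hasDerivAt_truncFracIntegral hP hu hw).deriv, Nat.cast_succ, sub_sub]

theorem intervalIntegrable_fracKernel {μ : ℝ} (hμ : 0 < μ) (a b : ℝ) :
    IntervalIntegrable (fracKernel μ) volume a b :=
  (intervalIntegral.intervalIntegrable_rpow' (by linarith)).div_const _

theorem intervalIntegrable_fracKernel_sub_mul {μ : ℝ} (hμ : 0 < μ) {w : ℝ → ℝ}
    (hw : Continuous w) (u a b : ℝ) :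
    IntervalIntegrable (fun s ↦ fracKernel μ (u - s) * w s) volume a b := by
  have h := (intervalIntegrable_fracKernel hμ (u - a) (u - b)).comp_sub_left u
  simp only [sub_sub_cancel] at h
  exact h.mul_continuousOn hw.continuousOn

theorem fracIntegral_add_period {μ P : ℝ} (hμ : 0 < μ) {w : ℝ → ℝ} (hw : Continuous w)
    (hper : Function.Periodic w P) (u : ℝ) :
    fracIntegral μ w (u + P) = truncFracIntegral μ P w (u + P) + fracIntegral μ w u := by
  have hshift := intervalIntegral.integral_comp_add_right (a := 0) (b := u)
    (fun s ↦ fracKernel μ (u + P - s) * w s) P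
  simp only [hper _, add_sub_add_right_eq_sub, zero_add] at hshift
  rw [fracIntegral, truncFracIntegral, fracIntegral, hshift,
    intervalIntegral.integral_add_adjacent_intervals] <;>
  exact intervalIntegrable_fracKernel_sub_mul hμ hw _ _ _

-- In this form `u` no longer meets the singularity of the kernel.
theorem fracIntegral_eq_rpow_mul_integral (μ : ℝ) (g : ℝ → ℝ) {u : ℝ} (hu : 0 < u) :
    fracIntegral μ g u = u ^ μ * ∫ y in (0 : ℝ)..1, g (u * (1 - y)) * fracKernel μ y := by
  have hreflect := intervalIntegral.integral_comp_sub_left (a := 0) (b := u)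
    (fun v ↦ fracKernel μ v * g (u - v)) u
  have hscale := intervalIntegral.smul_integral_comp_mul_left (a := 0) (b := 1)
    (fun v ↦ fracKernel μ v * g (u - v)) u
  simp only [sub_sub_cancel, sub_self, sub_zero] at hreflect
  simp only [mul_zero, mul_one, smul_eq_mul] at hscale
  rw [fracIntegral, hreflect, ← hscale, ← intervalIntegral.integral_const_mul,
    ← intervalIntegral.integral_const_mul]
  refine intervalIntegral.integral_congr fun y hy ↦ ?_
  rw [Set.uIcc_of_le zero_le_one] at hy
  simp only [fracKernel, Real.mul_rpow hu.le hy.1, Real.rpow_sub_one hu.ne', mul_one_sub]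
  field_simp

theorem contDiffOn_fracIntegral {μ : ℝ} (hμ : 0 < μ) {n : ℕ} {g : ℝ → ℝ} (hg : ContDiff ℝ n g) :
    ContDiffOn ℝ n (fracIntegral μ g) (Set.Ioi 0) := by
  have hrpow : ContDiffOn ℝ n (fun u : ℝ ↦ u ^ μ) (Set.Ioi 0) :=
    contDiffOn_id.rpow_const_of_ne fun u hu ↦ (Set.mem_Ioi.1 hu).ne'
  refine (hrpow.mul (contDiff_integral_mul_comp_mul (intervalIntegrable_fracKernel hμ 0 1) hg
    (ψ := fun y ↦ 1 - y) (by fun_prop)).contDiffOn).congr fun u hu ↦ ?_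
  exact fracIntegral_eq_rpow_mul_integral μ g hu

theorem eqOn_zero_of_frequently_truncFracIntegral_eq_zero {μ P : ℝ} (hμ : ∀ j : ℤ, μ ≠ j)
    (hP : 0 < P) {w : ℝ → ℝ} (hw : ContinuousOn w (Set.Icc 0 P))
    (h : ∃ᶠ u in atTop, truncFracIntegral μ P w u = 0) : Set.EqOn w 0 (Set.Icc 0 P) := by
  have hΓ : Real.Gamma μ ≠ 0 := Real.Gamma_ne_zero fun j hj ↦ hμ (-j) (by simpa using hj)
  have hμ1 (j : ℕ) : μ - 1 ≠ j := fun hj ↦ hμ (j + 1) (by push_cast; linarith)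
  have hint : IntervalIntegrable w volume 0 P := hw.intervalIntegrable_of_Icc hP.le
  refine eqOn_zero_of_integral_pow_mul_eq_zero hP hw
    (integral_pow_mul_eq_zero_of_frequently hμ1 hP.le hint (h.mono fun u hu ↦ ?_))
  simp_rw [truncFracIntegral, fracKernel, div_mul_eq_mul_div, intervalIntegral.integral_div] at hu
  exact (div_eq_zero_iff.1 hu).resolve_right hΓ

theorem eq_zero_of_frequently_truncFracIntegral_eq_zero {μ P : ℝ} (hμ : ∀ j : ℤ, μ ≠ j)
    (hP : 0 < P) {w : ℝ → ℝ} (hw : Continuous w) (hper : Function.Periodic w P)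
    (h : ∃ᶠ u in atTop, truncFracIntegral μ P w u = 0) : w = 0 := by
  funext t
  obtain ⟨s, hs, hts⟩ := hper.exists_mem_Ico₀ hP t
  rw [hts]
  exact eqOn_zero_of_frequently_truncFracIntegral_eq_zero hμ hP hw.continuousOn h
    (Set.Ico_subset_Icc_self hs)

/-! ### Riemann sums -/

theorem integral_comp_natFloor (a : ℕ → ℝ) (N : ℕ) :
    ∫ x in (0 : ℝ)..N, a ⌊x⌋₊ = ∑ i ∈ Finset.range N, a i := by
  have hconst (i : ℕ) :
      Set.EqOn (fun _ ↦ a i) (fun x : ℝ ↦ a ⌊x⌋₊) (Set.uIoo (i : ℝ) (i + 1 : ℕ)) := by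
    intro x hx
    rw [Set.uIoo_of_le (by simp), Nat.cast_succ] at hx
    simp only [Nat.floor_eq_on_Ico i x (Set.Ioo_subset_Ico_self hx)]
  have hadjacent := intervalIntegral.sum_integral_adjacent_intervals (μ := volume)
    (a := fun i : ℕ ↦ (i : ℝ)) (n := N) fun i _ ↦
      (intervalIntegrable_const (c := a i)).congr_uIoo (hconst i)
  rw [← Nat.cast_zero, ← hadjacent]
  refine Finset.sum_congr rfl fun i _ ↦ ?_
  rw [← intervalIntegral.integral_congr_uIoo (hconst i), intervalIntegral.integral_const,
    Nat.cast_succ, add_sub_cancel_left, one_smul]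

theorem div_mul_sum_range_eq_integral {P : ℝ} (hP : P ≠ 0) (a : ℕ → ℝ) {N : ℕ} (hN : N ≠ 0) :
    P / N * ∑ i ∈ Finset.range N, a i = ∫ x in (0 : ℝ)..P, a ⌊x / (P / N)⌋₊ := by
  have hN' : (N : ℝ) ≠ 0 := Nat.cast_ne_zero.2 hN
  rw [intervalIntegral.integral_comp_div (fun y : ℝ ↦ a ⌊y⌋₊) (div_ne_zero hP hN'), zero_div,
    div_div_cancel₀ hP, integral_comp_natFloor, smul_eq_mul]

theorem tendsto_natFloor_div_mul_div {P x : ℝ} (hP : 0 < P) (hx : 0 ≤ x) :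
    Tendsto (fun N : ℕ ↦ (⌊x / (P / N)⌋₊ : ℝ) * (P / N)) atTop (𝓝 x) := by
  have h := ((tendsto_nat_floor_mul_div_atTop (div_nonneg hx hP.le)).comp
    tendsto_natCast_atTop_atTop).mul_const P
  rw [div_mul_cancel₀ _ hP.ne'] at h
  refine h.congr fun N ↦ ?_
  rw [Function.comp_apply, div_div_eq_mul_div, div_mul_eq_mul_div, div_mul_eq_mul_div,
    mul_div_assoc]

theorem tendsto_weighted_riemannSum {P : ℝ} (hP : 0 < P) {φ : ℝ → ℝ}
    (hφ : ContinuousOn φ (Set.Icc 0 P)) {d : ℕ → ℝ} {L : ℝ} (hd : Tendsto d atTop (𝓝 L))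
    {m : ℕ → ℕ → ℕ} (hm : ∀ N i, N ≤ m N i) :
    Tendsto (fun N : ℕ ↦ P / N * ∑ i ∈ Finset.range N, d (m N i) * φ (i * (P / N))) atTop
      (𝓝 (L * ∫ x in (0 : ℝ)..P, φ x)) := by
  obtain ⟨B, hB⟩ := isCompact_Icc.exists_bound_of_continuousOn hφ
  obtain ⟨D, hD⟩ := (Metric.isBounded_range_of_tendsto d hd).exists_norm_le
  let step (N : ℕ) (x : ℝ) : ℕ := ⌊x / (P / N)⌋₊
  have hmem (N : ℕ) {x : ℝ} (hx : x ∈ Set.Icc 0 P) : step N x * (P / N) ∈ Set.Icc 0 P := by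
    have hPN : 0 ≤ P / N := by positivity
    refine ⟨by positivity, le_trans ?_ hx.2⟩
    exact mul_le_of_le_div₀ hx.1 hPN (Nat.floor_le (div_nonneg hx.1 hPN))
  have hIcc {x : ℝ} (hx : x ∈ Set.uIoc 0 P) : x ∈ Set.Icc 0 P :=
    Set.Ioc_subset_Icc_self (Set.uIoc_of_le hP.le ▸ hx)
  have hlim : Tendsto
      (fun N ↦ ∫ x in (0 : ℝ)..P, d (m N (step N x)) * φ (step N x * (P / N))) atTop
      (𝓝 (∫ x in (0 : ℝ)..P, L * φ x)) := by
    refine intervalIntegral.tendsto_integral_filter_of_dominated_convergence (fun _ ↦ D * B)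
      (.of_forall fun N ↦ ?_) (.of_forall fun N ↦ .of_forall fun x hx ↦ ?_)
      intervalIntegrable_const (.of_forall fun x hx ↦ ?_)
    · exact ((measurable_from_nat (f := fun i ↦ d (m N i) * φ (i * (P / N)))).comp
        (Nat.measurable_floor.comp (measurable_id.div_const _))).aestronglyMeasurable
    · rw [norm_mul]
      have hd_le := hD _ (Set.mem_range_self (m N (step N x)))
      exact mul_le_mul hd_le (hB _ (hmem N (hIcc hx))) (norm_nonneg _)
        ((norm_nonneg _).trans hd_le)
    · refine (hd.comp (tendsto_atTop_mono (fun N ↦ hm N _) tendsto_id)).mul ?_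
      refine (hφ x (hIcc hx)).tendsto.comp (tendsto_nhdsWithin_iff.2 ⟨?_, ?_⟩)
      · exact tendsto_natFloor_div_mul_div hP (hIcc hx).1
      · exact .of_forall fun N ↦ hmem N (hIcc hx)
  rw [intervalIntegral.integral_const_mul] at hlim
  refine hlim.congr' ?_
  filter_upwards [eventually_ne_atTop 0] with N hN
  exact (div_mul_sum_range_eq_integral hP.ne' (fun i ↦ d (m N i) * φ (i * (P / N))) hN).symm

/-! ### Increments of fractional derivatives of periodic functions -/

theorem apply_add_natCast_mul_of_apply_add {β : Type*} {f : ℝ → β} {P : ℝ} (hP : 0 ≤ P)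
    (hf : ∀ t, 0 < t → f (t + P) = f t) (N : ℕ) {t : ℝ} (ht : 0 < t) :
    f (t + N * P) = f t := by
  induction N with
  | zero => rw [Nat.cast_zero, zero_mul, add_zero]
  | succ N ih => rw [Nat.cast_succ, add_one_mul, ← add_assoc, hf _ (by positivity), ih]

theorem exists_periodic_eqOn_Ioi {β : Type*} {f : ℝ → β} {P : ℝ} (hP : 0 < P)
    (hf : ∀ t, 0 < t → f (t + P) = f t) :
    ∃ F : ℝ → β, Function.Periodic F P ∧ Set.EqOn f F (Set.Ioi 0) := by
  refine ⟨fun t ↦ f (toIocMod hP 0 t), fun t ↦ by simp only [toIocMod_add_right], fun t ht ↦ ?_⟩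
  obtain ⟨hmod_pos, hmod_le⟩ := toIocMod_mem_Ioc hP 0 t
  have hdecomp := toIocMod_add_toIocDiv_zsmul hP 0 t
  have hdiv : 0 ≤ toIocDiv hP 0 t := by
    refine Int.lt_add_one_iff.1 (lt_of_mul_lt_mul_right (a := P) ?_ hP.le |> Int.cast_lt.1)
    rw [zsmul_eq_mul] at hdecomp
    push_cast
    linarith [Set.mem_Ioi.1 ht]
  obtain ⟨N, hN⟩ := Int.eq_ofNat_of_zero_le hdiv
  rw [hN, zsmul_eq_mul, Int.cast_natCast] at hdecomp
  calc f t = f (toIocMod hP 0 t + N * P) := by rw [hdecomp]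
    _ = f (toIocMod hP 0 t) := apply_add_natCast_mul_of_apply_add hP.le hf N hmod_pos

theorem contDiff_of_periodic_of_contDiffOn_Ioi {n : ℕ} {G : ℝ → ℝ} {P : ℝ} (hP : 0 < P)
    (hper : Function.Periodic G P) (hG : ContDiffOn ℝ n G (Set.Ioi 0)) : ContDiff ℝ n G := by
  refine contDiff_iff_contDiffAt.2 fun t ↦ ?_
  obtain ⟨N, hN⟩ := exists_nat_gt (-t / P)
  have hpos : 0 < t + N * P := by linarith [(div_lt_iff₀ hP).1 hN]
  have hshift : (fun s ↦ G (s + N * P)) = G := funext (hper.nat_mul N)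
  rw [← hshift]
  exact ContDiffAt.comp t (hG.contDiffAt (Ioi_mem_nhds hpos)) (by fun_prop)

theorem periodic_iteratedDeriv {g : ℝ → ℝ} {P : ℝ} (hg : Function.Periodic g P) (n : ℕ) :
    Function.Periodic (iteratedDeriv n g) P := fun t ↦ by
  have h := congrFun (iteratedDeriv_comp_add_const n g P) t
  rw [funext hg] at h
  exact h.symm

theorem exists_eq_const_of_periodic_of_iteratedDeriv_eq_zero {n : ℕ} {G : ℝ → ℝ} {P : ℝ}
    (hP : 0 < P) (hG : ContDiff ℝ n G) (hper : Function.Periodic G P)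
    (h : iteratedDeriv n G = 0) : ∃ c, ∀ t, G t = c := by
  induction n generalizing G with
  | zero => exact ⟨0, congrFun (iteratedDeriv_zero.symm.trans h)⟩
  | succ n ih =>
    push_cast at hG
    obtain ⟨hG_diff, -, hG'⟩ := contDiff_succ_iff_deriv.1 hG
    have hper' : Function.Periodic (deriv G) P := by
      simpa only [iteratedDeriv_one] using periodic_iteratedDeriv hper 1
    obtain ⟨c, hc⟩ := ih hG' hper' (iteratedDeriv_succ'.symm.trans h)
    obtain ⟨ξ, -, hξ⟩ := exists_deriv_eq_zero hP hG_diff.continuous.continuousOn (hper.eq).symm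
    have hderiv (t : ℝ) : deriv G t = 0 := by rw [hc, ← hc ξ, hξ]
    exact ⟨G 0, fun t ↦ is_const_of_deriv_eq_zero hG_diff hderiv t 0⟩

theorem fracOrder_sub_pos (α : ℝ) : 0 < fracOrder α - α := by
  rw [fracOrder, Nat.cast_succ, sub_pos]
  exact Nat.lt_floor_add_one α

theorem fracIntegral_congr {μ : ℝ} {g G : ℝ → ℝ} (h : Set.EqOn g G (Set.Ioi 0)) :
    Set.EqOn (fracIntegral μ g) (fracIntegral μ G) (Set.Ioi 0) := fun u hu ↦
  intervalIntegral.integral_congr_Ioo_of_le (Set.mem_Ioi.1 hu).le fun s hs ↦ by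
    simp only [h hs.1]

theorem caputoDeriv_eq_fracIntegral (α : ℝ) (g : ℝ → ℝ) :
    caputoDeriv α g = fracIntegral (fracOrder α - α) (iteratedDeriv (fracOrder α) g) := by
  funext t
  simp_rw [caputoDeriv, fracIntegral, fracKernel, ← intervalIntegral.integral_const_mul]
  exact intervalIntegral.integral_congr fun s _ ↦ by ring

theorem rlDeriv_eq_iteratedDeriv_fracIntegral (α : ℝ) (g : ℝ → ℝ) :
    rlDeriv α g = iteratedDeriv (fracOrder α) (fracIntegral (fracOrder α - α) g) := by
  funext t
  rw [rlDeriv, ← iteratedDeriv_const_mul_field]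
  congr 1
  funext u
  simp_rw [fracIntegral, fracKernel, ← intervalIntegral.integral_const_mul]
  exact intervalIntegral.integral_congr fun s _ ↦ by ring

theorem caputoDeriv_congr {α : ℝ} {g G : ℝ → ℝ} (h : Set.EqOn g G (Set.Ioi 0)) :
    Set.EqOn (caputoDeriv α g) (caputoDeriv α G) (Set.Ioi 0) := by
  simp_rw [caputoDeriv_eq_fracIntegral]
  exact fracIntegral_congr (h.iteratedDeriv_of_isOpen isOpen_Ioi _)

theorem rlDeriv_congr {α : ℝ} {g G : ℝ → ℝ} (h : Set.EqOn g G (Set.Ioi 0)) :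
    Set.EqOn (rlDeriv α g) (rlDeriv α G) (Set.Ioi 0) := by
  simp_rw [rlDeriv_eq_iteratedDeriv_fracIntegral]
  exact (fracIntegral_congr h).iteratedDeriv_of_isOpen isOpen_Ioi _

theorem caputoDeriv_add_period_sub {α P : ℝ} {G : ℝ → ℝ} (hG : ContDiff ℝ (fracOrder α) G)
    (hper : Function.Periodic G P) (t : ℝ) :
    caputoDeriv α G (t + P) - caputoDeriv α G t =
      truncFracIntegral (fracOrder α - α) P (iteratedDeriv (fracOrder α) G) (t + P) := by
  rw [caputoDeriv_eq_fracIntegral, fracIntegral_add_period (fracOrder_sub_pos α)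
    (hG.continuous_iteratedDeriv _ le_rfl) (periodic_iteratedDeriv hper _), add_sub_cancel_right]

theorem rlDeriv_add_period_sub {α P : ℝ} (hP : 0 ≤ P) {G : ℝ → ℝ}
    (hG : ContDiff ℝ (fracOrder α) G) (hper : Function.Periodic G P) {t : ℝ} (ht : 0 < t) :
    rlDeriv α G (t + P) - rlDeriv α G t = truncFracIntegral (-α) P G (t + P) := by
  have hsmooth {u : ℝ} (hu : 0 < u) :
      ContDiffAt ℝ (fracOrder α) (fracIntegral (fracOrder α - α) G) u :=
    (contDiffOn_fracIntegral (fracOrder_sub_pos α) hG).contDiffAt (Ioi_mem_nhds hu)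
  have hsmooth_shift :
      ContDiffAt ℝ (fracOrder α) (fun u ↦ fracIntegral (fracOrder α - α) G (u + P)) t :=
    (hsmooth (u := t + P) (by linarith)).comp t (contDiffAt_id.add contDiffAt_const)
  have hincrement : (fun u ↦ fracIntegral (fracOrder α - α) G (u + P)
      - fracIntegral (fracOrder α - α) G u)
      = fun u ↦ truncFracIntegral (fracOrder α - α) P G (u + P) := by
    funext u
    rw [fracIntegral_add_period (fracOrder_sub_pos α) hG.continuous hper, add_sub_cancel_right]
  rw [rlDeriv_eq_iteratedDeriv_fracIntegral]
  calc iteratedDeriv (fracOrder α) (fracIntegral (fracOrder α - α) G) (t + P)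
        - iteratedDeriv (fracOrder α) (fracIntegral (fracOrder α - α) G) t
      = iteratedDeriv (fracOrder α) (fun u ↦ fracIntegral (fracOrder α - α) G (u + P)
          - fracIntegral (fracOrder α - α) G u) t := by
        rw [iteratedDeriv_fun_sub hsmooth_shift (hsmooth ht), iteratedDeriv_comp_add_const]
    _ = iteratedDeriv (fracOrder α) (truncFracIntegral (fracOrder α - α) P G) (t + P) := by
        rw [hincrement, iteratedDeriv_comp_add_const]
    _ = truncFracIntegral (-α) P G (t + P) := by
        rw [iteratedDeriv_truncFracIntegral hP (hG.continuous.intervalIntegrable _ _) _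
          (Set.mem_Ioi.2 (lt_add_of_pos_left P ht)), sub_sub_cancel_left]

theorem rpow_eq_rpow_neg_mul_mul_rpow {h r : ℝ} (hh : 0 ≤ h) (hr : 0 < r) (b : ℝ) :
    h ^ b = r ^ (-b) * (r * h) ^ b := by
  rw [Real.mul_rpow hr.le hh, ← mul_assoc, ← Real.rpow_add hr, neg_add_cancel, Real.rpow_zero,
    one_mul]

theorem tendsto_rpow_neg_mul_neg_one_pow_mul_choose {α P : ℝ} (hα : ∀ j : ℕ, α ≠ j) (hP : 0 < P)
    {j : ℕ} (hj : 0 < j) :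
    Tendsto (fun N : ℕ ↦ (P / N) ^ (-α) * ((-1) ^ (j * N) * Ring.choose α (j * N))) atTop
      (𝓝 0) := by
  have hcoeff := ((tendsto_neg_one_pow_mul_choose_mul_rpow hα).comp
    (tendsto_id.const_mul_atTop' hj)).mul_const ((j * P) ^ (-α))
  rw [zero_mul] at hcoeff
  refine hcoeff.congr' ?_
  filter_upwards [eventually_gt_atTop 0] with N hN
  have hjN : (0 : ℝ) < (j * N : ℕ) := Nat.cast_pos.2 (Nat.mul_pos hj hN)
  have hstep : ((j * N : ℕ) : ℝ) * (P / N) = j * P := by push_cast; field_simp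
  rw [rpow_eq_rpow_neg_mul_mul_rpow (h := P / N) (by positivity) hjN, hstep, neg_neg]
  simp only [Function.comp_apply, id_eq]
  ring

theorem tendsto_rpow_neg_mul_sum_choose_mul {α P : ℝ} (hα : ∀ j : ℕ, α ≠ j) (hP : 0 < P)
    {ψ : ℝ → ℝ} (hψ : ContinuousOn ψ (Set.Icc 0 P)) {j : ℕ} (hj : 0 < j) :
    Tendsto (fun N : ℕ ↦ (P / N) ^ (-α) * ∑ i ∈ Finset.range N,
        (-1) ^ (j * N + i) * Ring.choose α (j * N + i) * ψ (i * (P / N))) atTop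
      (𝓝 (∫ x in (0 : ℝ)..P, fracKernel (-α) (j * P + x) * ψ x)) := by
  have hjP : 0 < j * P := by positivity
  have hφ : ContinuousOn (fun x ↦ (j * P + x) ^ (-α - 1) * ψ x) (Set.Icc 0 P) := by
    refine ContinuousOn.mul (ContinuousOn.rpow_const (by fun_prop) fun x hx ↦ ?_) hψ
    exact Or.inl (add_pos_of_pos_of_nonneg hjP hx.1).ne'
  have hsum := tendsto_weighted_riemannSum hP hφ
    (tendsto_neg_one_pow_mul_choose_mul_rpow_add_one hα) (m := fun N i ↦ j * N + i)
    fun N i ↦ (Nat.le_mul_of_pos_left N hj).trans (Nat.le_add_right _ _)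
  rw [← intervalIntegral.integral_const_mul] at hsum
  simp_rw [fracKernel, div_mul_eq_mul_div, div_eq_inv_mul _ (Real.Gamma (-α))]
  refine hsum.congr' ?_
  filter_upwards [eventually_gt_atTop 0] with N hN
  have hh : 0 < P / N := by positivity
  rw [Finset.mul_sum, Finset.mul_sum]
  refine Finset.sum_congr rfl fun i _ ↦ ?_
  have hr : (0 : ℝ) < (j * N + i : ℕ) := by positivity
  have hgrid : ((j * N + i : ℕ) : ℝ) * (P / N) = j * P + i * (P / N) := by push_cast; field_simp
  have hscale : (P / N) ^ (-α)
      = P / N * (((j * N + i : ℕ) : ℝ) ^ (α + 1) * (j * P + i * (P / N)) ^ (-α - 1)) := by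
    rw [← hgrid, show α + 1 = -(-α - 1) by ring,
      ← rpow_eq_rpow_neg_mul_mul_rpow hh.le hr, mul_comm, ← Real.rpow_add_one hh.ne',
      sub_add_cancel]
  rw [hscale]
  ring

-- The last node of the sum is `0`, where `g` need not agree with its periodic extension.
theorem glQuotient_natCast_mul_div {α P : ℝ} (hP : 0 < P) {g G : ℝ → ℝ}
    (hper : Function.Periodic G P) (hgG : Set.EqOn g G (Set.Ioi 0)) (j : ℕ) {N : ℕ} (hN : 0 < N) :
    glQuotient α g (j * P) (P / N) = (P / N) ^ (-α) *
      (∑ r ∈ Finset.range (j * N), (-1) ^ r * Ring.choose α r * G (-(r * (P / N)))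
        + (-1) ^ (j * N) * Ring.choose α (j * N) * g 0) := by
  have hend : (j * N : ℕ) * (P / N) = j * P := by push_cast; field_simp
  have hfloor : ⌊j * P / (P / N)⌋₊ = j * N := by
    rw [← hend, mul_div_cancel_right₀ _ (by positivity), Nat.floor_natCast]
  rw [glQuotient, hfloor, Finset.sum_range_succ, hend, sub_self]
  congr 2
  refine Finset.sum_congr rfl fun r hr ↦ ?_
  have hpos : 0 < j * P - r * (P / N) := by
    rw [← hend, sub_pos]
    have hlt : (r : ℝ) < (j * N : ℕ) := Nat.cast_lt.2 (Finset.mem_range.1 hr)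
    gcongr
  rw [hgG hpos, sub_eq_neg_add, hper.nat_mul j]

theorem tendsto_glQuotient_add_period_sub {α P : ℝ} (hα : ∀ j : ℕ, α ≠ j) (hP : 0 < P)
    {g G : ℝ → ℝ} (hG : Continuous G) (hper : Function.Periodic G P)
    (hgG : Set.EqOn g G (Set.Ioi 0)) {j : ℕ} (hj : 0 < j) :
    Tendsto (fun N : ℕ ↦ glQuotient α g (j * P + P) (P / N) - glQuotient α g (j * P) (P / N)) atTop
      (𝓝 (truncFracIntegral (-α) P G (j * P + P))) := by
  have hreflect : ∫ x in (0 : ℝ)..P, fracKernel (-α) (j * P + x) * G (-x)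
      = truncFracIntegral (-α) P G (j * P + P) := by
    have h := intervalIntegral.integral_comp_sub_left (a := 0) (b := P)
      (fun s ↦ fracKernel (-α) (j * P + P - s) * G s) P
    simp only [sub_self, sub_zero] at h
    simp only [sub_eq_neg_add P, hper _] at h
    rw [truncFracIntegral, ← h]
    exact intervalIntegral.integral_congr fun x _ ↦ by ring_nf
  have hsum := tendsto_rpow_neg_mul_sum_choose_mul hα hP (ψ := fun x ↦ G (-x)) (by fun_prop) hj
  have hboundary := ((tendsto_rpow_neg_mul_neg_one_pow_mul_choose hα hP j.succ_pos).sub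
    (tendsto_rpow_neg_mul_neg_one_pow_mul_choose hα hP hj)).mul_const (g 0)
  have hlim := hsum.add hboundary
  rw [hreflect, sub_zero, zero_mul, add_zero] at hlim
  refine hlim.congr' ?_
  filter_upwards [eventually_gt_atTop 0] with N hN
  have hshift (i : ℕ) : G (-((j * N + i : ℕ) * (P / N))) = G (-(i * (P / N))) := by
    rw [← hper.nat_mul j (-((j * N + i : ℕ) * (P / N)))]
    congr 1
    push_cast
    field_simp
    ring
  rw [← add_one_mul, ← Nat.cast_succ, glQuotient_natCast_mul_div hP hper hgG _ hN,
    glQuotient_natCast_mul_div hP hper hgG _ hN, Nat.succ_mul, Finset.sum_range_add]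
  simp_rw [hshift]
  ring

/-! ### Periodic functions with periodic fractional derivatives -/

theorem tendsto_const_div_natCast_nhdsGT {P : ℝ} (hP : 0 < P) :
    Tendsto (fun N : ℕ ↦ P / N) atTop (𝓝[>] 0) := by
  refine tendsto_nhdsWithin_iff.2 ⟨tendsto_const_div_atTop_nhds_zero_nat P, ?_⟩
  filter_upwards [eventually_gt_atTop 0] with N hN
  exact div_pos hP (Nat.cast_pos.2 hN)

theorem truncFracIntegral_eq_zero_of_tendsto_glQuotient {α P : ℝ} (hα : ∀ j : ℕ, α ≠ j)
    (hP : 0 < P) {g G y : ℝ → ℝ} (hG : Continuous G) (hper : Function.Periodic G P)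
    (hgG : Set.EqOn g G (Set.Ioi 0))
    (hy : ∀ t, 0 < t → Tendsto (glQuotient α g t) (𝓝[>] 0) (𝓝 (y t)))
    (hyper : ∀ t, 0 < t → y (t + P) = y t) {j : ℕ} (hj : 0 < j) :
    truncFracIntegral (-α) P G (j * P + P) = 0 := by
  have hstep := tendsto_const_div_natCast_nhdsGT hP
  have hlim := ((hy (j * P + P) (by positivity)).comp hstep).sub
    ((hy (j * P) (by positivity)).comp hstep)
  rw [hyper _ (by positivity), sub_self] at hlim
  exact tendsto_nhds_unique (tendsto_glQuotient_add_period_sub hα hP hG hper hgG hj) hlim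

theorem eqOn_const_of_caputoDeriv_periodic {α P : ℝ} (hα : ∀ j : ℤ, α ≠ j) (hP : 0 < P)
    {g G : ℝ → ℝ} (hG : ContDiff ℝ (fracOrder α) G) (hper : Function.Periodic G P)
    (hgG : Set.EqOn g G (Set.Ioi 0))
    (hD : ∀ t, 0 < t → caputoDeriv α g (t + P) = caputoDeriv α g t) :
    ∃ c, Set.EqOn g (fun _ ↦ c) (Set.Ioi 0) := by
  have hμ (j : ℤ) : fracOrder α - α ≠ j := fun h ↦ hα (fracOrder α - j) (by push_cast; linarith)
  have hzero : ∀ᶠ u in atTop,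
      truncFracIntegral (fracOrder α - α) P (iteratedDeriv (fracOrder α) G) u = 0 := by
    filter_upwards [eventually_gt_atTop P] with u hu
    have ht : 0 < u - P := sub_pos.2 hu
    have hu0 : 0 < u - P + P := by positivity
    rw [← sub_add_cancel u P, ← caputoDeriv_add_period_sub hG hper, ← caputoDeriv_congr hgG ht,
      ← caputoDeriv_congr hgG hu0, hD _ ht, sub_self]
  have hderiv := eq_zero_of_frequently_truncFracIntegral_eq_zero hμ hP
    (hG.continuous_iteratedDeriv _ le_rfl) (periodic_iteratedDeriv hper _) hzero.frequently
  obtain ⟨c, hc⟩ := exists_eq_const_of_periodic_of_iteratedDeriv_eq_zero hP hG hper hderiv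
  exact ⟨c, fun t ht ↦ (hgG ht).trans (hc t)⟩

theorem eqOn_zero_of_rlDeriv_periodic {α P : ℝ} (hα : ∀ j : ℤ, α ≠ j) (hP : 0 < P)
    {g G : ℝ → ℝ} (hG : ContDiff ℝ (fracOrder α) G) (hper : Function.Periodic G P)
    (hgG : Set.EqOn g G (Set.Ioi 0)) (hD : ∀ t, 0 < t → rlDeriv α g (t + P) = rlDeriv α g t) :
    Set.EqOn g 0 (Set.Ioi 0) := by
  have hμ (j : ℤ) : -α ≠ j := fun h ↦ hα (-j) (by push_cast; linarith)
  have hzero : ∀ᶠ u in atTop, truncFracIntegral (-α) P G u = 0 := by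
    filter_upwards [eventually_gt_atTop P] with u hu
    have ht : 0 < u - P := sub_pos.2 hu
    have hu0 : 0 < u - P + P := by positivity
    rw [← sub_add_cancel u P, ← rlDeriv_add_period_sub hP.le hG hper ht, ← rlDeriv_congr hgG ht,
      ← rlDeriv_congr hgG hu0, hD _ ht, sub_self]
  exact eq_zero_of_frequently_truncFracIntegral_eq_zero hμ hP hG.continuous hper
    hzero.frequently ▸ hgG

theorem eqOn_zero_of_tendsto_glQuotient_periodic {α P : ℝ} (hα : ∀ j : ℤ, α ≠ j) (hP : 0 < P)
    {g G y : ℝ → ℝ} (hG : Continuous G) (hper : Function.Periodic G P)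
    (hgG : Set.EqOn g G (Set.Ioi 0))
    (hy : ∀ t, 0 < t → Tendsto (glQuotient α g t) (𝓝[>] 0) (𝓝 (y t)))
    (hyper : ∀ t, 0 < t → y (t + P) = y t) : Set.EqOn g 0 (Set.Ioi 0) := by
  have hμ (j : ℤ) : -α ≠ j := fun h ↦ hα (-j) (by push_cast; linarith)
  have htimes : Tendsto (fun j : ℕ ↦ j * P + P) atTop atTop :=
    tendsto_atTop_add_const_right _ _ (tendsto_natCast_atTop_atTop.atTop_mul_const hP)
  have hzero : ∀ᶠ j : ℕ in atTop, truncFracIntegral (-α) P G (j * P + P) = 0 := by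
    filter_upwards [eventually_gt_atTop 0] with j hj
    exact truncFracIntegral_eq_zero_of_tendsto_glQuotient (fun j ↦ by exact_mod_cast hα j) hP hG
      hper hgG hy hyper hj
  exact eq_zero_of_frequently_truncFracIntegral_eq_zero hμ hP hG hper
    (htimes.frequently hzero.frequently) ▸ hgG

theorem eqOn_const_of_hasFracDeriv_periodic {K : FracKind} {α P : ℝ} (hα : ∀ j : ℤ, α ≠ j)
    (hP : 0 < P) {g y : ℝ → ℝ} (hg : ContDiffOn ℝ (fracOrder α) g (Set.Ioi 0))
    (hper : ∀ t, 0 < t → g (t + P) = g t) (hy : ∀ t, 0 < t → HasFracDeriv K α g t (y t))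
    (hyper : ∀ t, 0 < t → y (t + P) = y t) : ∃ c, Set.EqOn g (fun _ ↦ c) (Set.Ioi 0) := by
  obtain ⟨G, hGper, hgG⟩ := exists_periodic_eqOn_Ioi hP hper
  have hG := contDiff_of_periodic_of_contDiffOn_Ioi hP hGper (hg.congr hgG.symm)
  cases K with
  | caputo =>
    refine eqOn_const_of_caputoDeriv_periodic hα hP hG hGper hgG fun t ht ↦ ?_
    exact (hy _ (by positivity)).trans ((hyper t ht).trans (hy t ht).symm)
  | riemannLiouville =>
    refine ⟨0, eqOn_zero_of_rlDeriv_periodic hα hP hG hGper hgG fun t ht ↦ ?_⟩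
    exact (hy _ (by positivity)).trans ((hyper t ht).trans (hy t ht).symm)
  | grunwaldLetnikov =>
    exact ⟨0, eqOn_zero_of_tendsto_glQuotient_periodic hα hP hG.continuous hGper hgG hy hyper⟩

theorem iteratedDeriv_add_period_of_pos {g : ℝ → ℝ} {P : ℝ}
    (hg : ∀ t, 0 < t → g (t + P) = g t) (n : ℕ) {t : ℝ} (ht : 0 < t) :
    iteratedDeriv n g (t + P) = iteratedDeriv n g t := by
  rw [← congrFun (iteratedDeriv_comp_add_const n g P) t]
  exact Set.EqOn.iteratedDeriv_of_isOpen (s := Set.Ioi 0) hg isOpen_Ioi n ht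

theorem ne_intCast_of_pos {a : ℝ} (ha : 0 < a) (h : ∀ j : ℕ, a ≠ j) (j : ℤ) : a ≠ j := by
  rintro rfl
  lift j to ℕ using (Int.cast_pos.1 ha).le
  exact h j (Int.cast_natCast j)

theorem corollary2_general {p m : ℕ} {K : Fin p → FracKind} {α : Fin p → ℝ}
    (hα : ∀ i, ∀ j : ℤ, α i ≠ j) {T : ℝ} (hT : 0 < T)
    {f : ℝ → (Fin (m + 1) → Fin p → ℝ) → Fin p → ℝ}
    (hf : ∀ t, 0 < t → ∀ v, f (t + T) v = f t v) {k : ℕ} (hk : 1 ≤ k) {x : ℝ → Fin p → ℝ}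
    (hx : IsClassCn α x) (hsol : IsFracSolution K α m f x)
    (hper : ∀ t, 0 < t → x (t + k * T) = x t) : ∃ c, ∀ t, 0 < t → x t = c := by
  have hkT : 0 < k * T := mul_pos (Nat.cast_pos.2 hk) hT
  have hper_coord (i : Fin p) (t : ℝ) (ht : 0 < t) : x (t + k * T) i = x t i := by rw [hper t ht]
  have hf_coord (i : Fin p) (t : ℝ) (ht : 0 < t) :
      f (t + k * T) (fun j l ↦ iteratedDeriv j (x · l) (t + k * T)) i
        = f t (fun j l ↦ iteratedDeriv j (x · l) t) i := by
    have hderiv (j : ℕ) (l : Fin p) :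
        iteratedDeriv j (x · l) (t + k * T) = iteratedDeriv j (x · l) t :=
      iteratedDeriv_add_period_of_pos (hper_coord l) j ht
    simp_rw [hderiv]
    rw [apply_add_natCast_mul_of_apply_add hT.le (fun t ht ↦ funext (hf t ht)) k ht]
  have hconst (i : Fin p) : ∃ c, Set.EqOn (x · i) (fun _ ↦ c) (Set.Ioi 0) :=
    eqOn_const_of_hasFracDeriv_periodic (hα i) hkT (hx i) (hper_coord i)
      (fun t ht ↦ (hsol t ht).2 i) (hf_coord i)
  choose c hc using hconst
  exact ⟨c, fun t ht ↦ funext fun i ↦ hc i ht⟩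

theorem corollary2 (p m : ℕ) (K : Fin p → FracKind) (α : Fin p → ℝ)
    (hα_pos : ∀ i, 0 < α i) (hα_nonint : ∀ i, ∀ j : ℕ, α i ≠ (j : ℝ))
    (T : ℝ) (hT : 0 < T)
    (f : ℝ → (Fin (m + 1) → Fin p → ℝ) → Fin p → ℝ)
    (hf : ∀ t : ℝ, 0 ≤ t → ∀ v, f (t + T) v = f t v)
    (k : ℕ) (hk : 1 ≤ k) :
    ¬ ∃ x : ℝ → Fin p → ℝ,
        IsClassCn α x ∧
        IsFracSolution K α m f x ∧
        (∀ t : ℝ, 0 < t → x (t + k * T) = x t) ∧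
        ¬ ∃ c : Fin p → ℝ, ∀ t : ℝ, 0 < t → x t = c := by
  rintro ⟨x, hx, hsol, hper, hnonconst⟩
  exact hnonconst (corollary2_general (fun i ↦ ne_intCast_of_pos (hα_pos i) (hα_nonint i)) hT
    (fun t ht ↦ hf t ht.le) hk hx hsol hper)
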